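/- Let $L\ge 1$ be an integer, let $\alpha,T,\hat r>0$ be real, and let $(\varphi_i)_{i\ge0}$ be real numbers with $\varphi_0\neq 0$. Let $R_1,\dots,R_L$ be i.i.d. $\alpha$-$\mu$ mixtures, i.e. independent real random variables, each with PDF $$f(r)=\alpha\exp\!\Big(-\frac{r^{\alpha}}{\hat r^{\alpha}}\Big)\sum_{i=0}^{\infty}\frac{\varphi_i\,r^{\alpha(i+T)-1}}{\hat r^{\alpha(i+T)}\,\Gamma(i+T)}\quad(r>0),\qquad f(r)=0\quad(r\le 0),$$ where the series converges absolutely for every $r>0$. For $i\ge 0$ put $$\lambda_i=\frac{\Gamma(\alpha(i+T))}{\hat r^{\alpha i}}\sum_{j=0}^{i}\frac{(-1)^{i-j}\varphi_j}{(i-j)!\,\Gamma(j+T)},$$ and define $$\delta_0=\lambda_0^L,\qquad \delta_i=\frac{1}{i\lambda_0}\sum_{h=1}^{i}\delta_{i-h}\,\lambda_h\,(hL+h-i)\quad(i\ge1).$$ Then the sum $R=\sum_{\ell=1}^L R_\ell$ has PDF and CDF $$f_R(r)=\frac{\alpha^L}{\hat r^{\alpha TL}}\sum_{i=0}^{\infty}\frac{\delta_i\,r^{\alpha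 i+\alpha LT-1}}{\Gamma(\alpha i+\alpha LT)}\quad(r>0),\qquad F_R(r)=\frac{\alpha^L}{\hat r^{\alpha TL}}\sum_{i=0}^{\infty}\frac{\delta_i\,r^{\alpha i+\alpha LT}}{\Gamma(1+\alpha i+\alpha LT)}\quad(r\ge0),$$ with $f_R(r)=0$ for $r\le 0$, $F_R(r)=0$ for $r<0$, and both series converging absolutely. Moreover, these formulas are what the formulas for non-identically distributed summands reduce to. For parameters $T_\ell,\hat r_\ell>0$ and coefficients $\lambda_{i,\ell}$ (formed as above from $T_\ell,\hat r_\ell,\varphi_{i,\ell}$), the latter are $$\alpha^L\Big(\prod_{\ell=1}^L\frac{1}{\hat r_\ell^{\alpha T_\ell}}\Big)\sum_{i=0}^\infty\frac{\delta'_i\,r^{-1+\alpha i+\alpha\sum_\ell T_\ell}}{\Gamma(i\alpha+\alpha\sum_\ell T_\ell)},\qquad \alpha^L\Big(\prod_{\ell=1}^L\frac{1}{\hat r_\ell^{\alpha T_\ell}}\Big)\sum_{i=0}^\infty\frac{\delta'_i\,r^{\alpha i+\alpha\sum_\ell T_\ell}}{\Gamma(1+i\alpha+\alpha\sum_\ell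 T_\ell)},$$ where $\delta'_0=\prod_\ell\lambda_{0,\ell}$, $\delta'_i=\frac1i\sum_{h=1}^i\delta'_{i-h}\sum_{\ell=1}^L\phi_{h-1,\ell}$ for $i\ge1$, $\phi_{0,\ell}=\lambda_{1,\ell}/\lambda_{0,\ell}$, and $\phi_{h,\ell}=\frac1{\lambda_{0,\ell}}\big[(h+1)\lambda_{h+1,\ell}-\sum_{t=1}^h\lambda_{t,\ell}\,\phi_{h-t,\ell}\big]$ for $h\ge1$. If $T_\ell=T$, $\hat r_\ell=\hat r$ and $\varphi_{i,\ell}=\varphi_i$ for all $\ell$, then $\delta'_i=\delta_i$ for all $i\ge 0$, and the two expressions equal $f_R(r)$ for $r>0$ and $F_R(r)$ for $r\ge0$ respectively. -/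

import Mathlib

open MeasureTheory ProbabilityTheory

noncomputable section

namespace AlphaMu

/-- The real random variable `X` is continuous with probability density function `f`
(with respect to Lebesgue measure on the line). -/
def HasDensity {Ω : Type*} [MeasurableSpace Ω] (X : Ω → ℝ) (P : Measure Ω) (f : ℝ → ℝ) : Prop :=
  HasPDF X P volume ∧ (∀ᵐ r ∂(volume : Measure ℝ), 0 ≤ f r) ∧
    pdf X P volume =ᵐ[volume] fun r => ENNReal.ofReal (f r)

/-- The `i`-th term of the series in the density of an `α`-`μ` mixture. -/
def mixtureTerm (α T rhat : ℝ) (φ : ℕ → ℝ) (r : ℝ) (i : ℕ) : ℝ :=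
  φ i * r ^ (α * (i + T) - 1) / (rhat ^ (α * (i + T)) * Real.Gamma (i + T))

/-- The density of an `α`-`μ` mixture, extended by zero to the nonpositive half-line. -/
def mixturePDF (α T rhat : ℝ) (φ : ℕ → ℝ) (r : ℝ) : ℝ :=
  if 0 < r then α * Real.exp (-(r ^ α / rhat ^ α)) * ∑' i : ℕ, mixtureTerm α T rhat φ r i else 0

/-- `X` is an `α`-`μ` mixture: the series in its density converges absolutely on `(0, ∞)`,
and `X` has that density. -/
def IsMixture {Ω : Type*} [MeasurableSpace Ω] (X : Ω → ℝ) (P : Measure Ω)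
    (α T rhat : ℝ) (φ : ℕ → ℝ) : Prop :=
  (∀ r : ℝ, 0 < r → Summable (mixtureTerm α T rhat φ r)) ∧
    HasDensity X P (mixturePDF α T rhat φ)

/-- The coefficients `λ_i` of an `α`-`μ` mixture. -/
def lam (α T rhat : ℝ) (φ : ℕ → ℝ) (i : ℕ) : ℝ :=
  Real.Gamma (α * (i + T)) / rhat ^ (α * i) *
    ∑ j ∈ Finset.range (i + 1),
      (-1 : ℝ) ^ (i - j) * φ j / ((i - j).factorial * Real.Gamma (j + T))

/-- The auxiliary coefficients `φ_h` attached to one coefficient sequence `a`. -/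
def aux (a : ℕ → ℝ) : ℕ → ℝ
  | 0 => a 1 / a 0
  | h + 1 => 1 / a 0 * ((h + 2) * a (h + 2) - ∑ t : Fin (h + 1), a (t + 1) * aux a (h - t))
  termination_by h => h
  decreasing_by omega

theorem aux_zero (a : ℕ → ℝ) : aux a 0 = a 1 / a 0 := by rw [aux]

theorem aux_rec (a : ℕ → ℝ) (h : ℕ) (hh : 1 ≤ h) :
    aux a h = 1 / a 0 * ((h + 1) * a (h + 1) - ∑ t ∈ Finset.Icc 1 h, a t * aux a (h - t)) := by
  obtain ⟨k, rfl⟩ : ∃ k, h = k + 1 := ⟨h - 1, by omega⟩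
  rw [aux, Fin.sum_univ_eq_sum_range (fun t => a (t + 1) * aux a (k - t)),
    ← Finset.Ico_add_one_right_eq_Icc, Finset.sum_Ico_eq_sum_range]
  congr 2
  · push_cast
    ring
  · apply Finset.sum_congr rfl
    intro t _
    rw [show k + 1 - (1 + t) = k - t by omega, add_comm 1 t]

/-- The coefficients `δ_i` of the sum of independent, not necessarily identically distributed
mixtures, where `a ℓ` is the coefficient sequence of the `ℓ`-th summand. -/
def deltaInid {L : ℕ} (a : Fin L → ℕ → ℝ) : ℕ → ℝ
  | 0 => ∏ l, a l 0
  | i + 1 => 1 / ((i : ℝ) + 1) *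
      ∑ h : Fin (i + 1), deltaInid a (i - h) * ∑ l, aux (a l) h
  termination_by i => i
  decreasing_by omega

theorem deltaInid_zero {L : ℕ} (a : Fin L → ℕ → ℝ) : deltaInid a 0 = ∏ l, a l 0 := by
  rw [deltaInid]

theorem deltaInid_rec {L : ℕ} (a : Fin L → ℕ → ℝ) (i : ℕ) (hi : 1 ≤ i) :
    deltaInid a i =
      1 / (i : ℝ) * ∑ h ∈ Finset.Icc 1 i, deltaInid a (i - h) * ∑ l, aux (a l) (h - 1) := by
  obtain ⟨k, rfl⟩ : ∃ k, i = k + 1 := ⟨i - 1, by omega⟩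
  rw [deltaInid, Fin.sum_univ_eq_sum_range (fun h => deltaInid a (k - h) * ∑ l, aux (a l) h),
    ← Finset.Ico_add_one_right_eq_Icc, Finset.sum_Ico_eq_sum_range]
  congr 1
  · push_cast
    ring
  · apply Finset.sum_congr rfl
    intro t _
    rw [show k + 1 - (1 + t) = k - t by omega, show 1 + t - 1 = t by omega]

/-- The coefficients `δ_i` of the sum of `L` i.i.d. mixtures with coefficient sequence `a`. -/
def deltaIid (L : ℕ) (a : ℕ → ℝ) : ℕ → ℝ
  | 0 => a 0 ^ L
  | i + 1 => 1 / (((i : ℝ) + 1) * a 0) *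
      ∑ h : Fin (i + 1), deltaIid L a (i - h) * a (h + 1) *
        (((h : ℕ) + 1 : ℝ) * L + ((h : ℕ) + 1 : ℝ) - ((i : ℝ) + 1))
  termination_by i => i
  decreasing_by omega

theorem deltaIid_zero (L : ℕ) (a : ℕ → ℝ) : deltaIid L a 0 = a 0 ^ L := by
  rw [deltaIid]

theorem deltaIid_rec (L : ℕ) (a : ℕ → ℝ) (i : ℕ) (hi : 1 ≤ i) :
    deltaIid L a i = 1 / ((i : ℝ) * a 0) *
      ∑ h ∈ Finset.Icc 1 i, deltaIid L a (i - h) * a h * ((h : ℝ) * L + h - i) := by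
  obtain ⟨k, rfl⟩ : ∃ k, i = k + 1 := ⟨i - 1, by omega⟩
  rw [deltaIid, Fin.sum_univ_eq_sum_range (fun h => deltaIid L a (k - h) * a (h + 1) *
      (((h : ℕ) + 1 : ℝ) * L + ((h : ℕ) + 1 : ℝ) - ((k : ℝ) + 1))),
    ← Finset.Ico_add_one_right_eq_Icc, Finset.sum_Ico_eq_sum_range]
  congr 1
  · push_cast
    ring
  · apply Finset.sum_congr rfl
    intro t _
    rw [show k + 1 - (1 + t) = k - t by omega, add_comm 1 t]
    push_cast
    ring

/-- The `i`-th term of the density series of the sum of independent mixtures. -/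
def pdfTermInid {L : ℕ} (α : ℝ) (T rhat : Fin L → ℝ) (φ : Fin L → ℕ → ℝ) (r : ℝ) (i : ℕ) : ℝ :=
  deltaInid (fun l => lam α (T l) (rhat l) (φ l)) i * r ^ (-1 + α * i + α * ∑ l, T l) /
    Real.Gamma (i * α + α * ∑ l, T l)

/-- The `i`-th term of the distribution function series of the sum of independent mixtures. -/
def cdfTermInid {L : ℕ} (α : ℝ) (T rhat : Fin L → ℝ) (φ : Fin L → ℕ → ℝ) (r : ℝ) (i : ℕ) : ℝ :=
  deltaInid (fun l => lam α (T l) (rhat l) (φ l)) i * r ^ (α * i + α * ∑ l, T l) /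
    Real.Gamma (1 + i * α + α * ∑ l, T l)

/-- The general density formula for the sum of independent mixtures, at `r > 0`. -/
def pdfInid {L : ℕ} (α : ℝ) (T rhat : Fin L → ℝ) (φ : Fin L → ℕ → ℝ) (r : ℝ) : ℝ :=
  α ^ L * (∏ l, 1 / rhat l ^ (α * T l)) * ∑' i : ℕ, pdfTermInid α T rhat φ r i

/-- The general distribution function formula for the sum of independent mixtures, at `r ≥ 0`. -/
def cdfInid {L : ℕ} (α : ℝ) (T rhat : Fin L → ℝ) (φ : Fin L → ℕ → ℝ) (r : ℝ) : ℝ :=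
  α ^ L * (∏ l, 1 / rhat l ^ (α * T l)) * ∑' i : ℕ, cdfTermInid α T rhat φ r i

/-- The `i`-th term of the density series of the sum of `L` i.i.d. mixtures. -/
def pdfTermIid (L : ℕ) (α T rhat : ℝ) (φ : ℕ → ℝ) (r : ℝ) (i : ℕ) : ℝ :=
  deltaIid L (lam α T rhat φ) i * r ^ (-1 + α * i + α * L * T) /
    Real.Gamma (i * α + α * L * T)

/-- The `i`-th term of the distribution function series of the sum of `L` i.i.d. mixtures. -/
def cdfTermIid (L : ℕ) (α T rhat : ℝ) (φ : ℕ → ℝ) (r : ℝ) (i : ℕ) : ℝ :=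
  deltaIid L (lam α T rhat φ) i * r ^ (α * i + α * L * T) /
    Real.Gamma (1 + i * α + α * L * T)

/-- The density formula for the sum of `L` i.i.d. mixtures, at `r > 0`. -/
def pdfIid (L : ℕ) (α T rhat : ℝ) (φ : ℕ → ℝ) (r : ℝ) : ℝ :=
  α ^ L / rhat ^ (α * T * L) * ∑' i : ℕ, pdfTermIid L α T rhat φ r i

/-- The distribution function formula for the sum of `L` i.i.d. mixtures, at `r ≥ 0`. -/
def cdfIid (L : ℕ) (α T rhat : ℝ) (φ : ℕ → ℝ) (r : ℝ) : ℝ :=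
  α ^ L / rhat ^ (α * T * L) * ∑' i : ℕ, cdfTermIid L α T rhat φ r i

end AlphaMu

end

/-
The function `r ^ (s - 1) / Γ s` has Laplace transform `z ↦ z ^ (-s)`, so, for a power series `p`,
`∑ pᵢ r ^ (α i + A - 1) / Γ(α i + A)` is formally the inverse Laplace transform of
`z ^ (-A) * p (z ^ (-α))`, and convolving two such functions multiplies the power series and adds
the exponents `A`. Euler's beta integral makes this rigorous without any Laplace transform.
Expanding the exponential in the density of a mixture shows that it has this form, with
coefficients proportional to `λᵢ`, so the density of a sum of independent mixtures corresponds to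
the product of the power series `∑ λᵢ,ₗ Xⁱ`. The recursions for `δ` and `δ'` both say that the
generating function has the logarithmic derivative, and the constant term, of that product.
Finally, the distribution function of a random variable is the convolution of its density with the
indicator of `(0, ∞)`, which is the series with `A = 1` and `p = 1`.
-/

namespace AlphaMu

open Finset PowerSeries

section LogarithmicDerivative

theorem eq_of_derivative_eq_mul {K : Type*} [CommRing K] [IsAddTorsionFree K] {f g h : K⟦X⟧}
    (hf : d⁄dX K f = h * f) (hg : d⁄dX K g = h * g) (h0 : coeff 0 f = coeff 0 g) : f = g := by
  ext n
  induction n using Nat.strong_induction_on with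
  | _ n ih =>
    cases n with
    | zero => exact h0
    | succ n =>
      have hcoeff : coeff n (d⁄dX K f) = coeff n (d⁄dX K g) := by
        rw [hf, hg, coeff_mul, coeff_mul]
        refine sum_congr rfl fun ij hij => ?_
        rw [ih ij.2 (Nat.lt_succ_of_le (HasAntidiagonal.antidiagonal.snd_le hij))]
      refine nsmul_right_injective n.succ_ne_zero ?_
      simpa only [coeff_derivative, nsmul_eq_mul, mul_comm, Nat.cast_succ] using hcoeff

theorem derivation_prod_of_eq_mul {R A ι : Type*} [CommSemiring R] [CommSemiring A] [Algebra R A]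
    (D : Derivation R A A) (s : Finset ι) {f g : ι → A} (h : ∀ i ∈ s, D (f i) = g i * f i) :
    D (∏ i ∈ s, f i) = (∑ i ∈ s, g i) * ∏ i ∈ s, f i := by
  induction s using Finset.cons_induction with
  | empty => simp
  | cons i s hi ih =>
    rw [prod_cons, sum_cons, D.leibniz, ih fun j hj => h j (mem_cons_of_mem hj),
      h i (mem_cons_self i s), smul_eq_mul, smul_eq_mul]
    ring

theorem derivative_mk_eq_mk_aux_mul {a : ℕ → ℝ} (ha : a 0 ≠ 0) :
    d⁄dX ℝ (mk a) = mk (aux a) * mk a := by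
  ext n
  rw [mul_comm, coeff_mul, coeff_derivative]
  simp only [coeff_mk]
  cases n with
  | zero => simp [aux_zero, mul_div_cancel₀ _ ha]
  | succ n =>
    rw [Nat.sum_antidiagonal_succ, Nat.sum_antidiagonal_eq_sum_range_succ_mk, aux,
      Fin.sum_univ_eq_sum_range (fun t => a (t + 1) * aux a (n - t))]
    push_cast
    field_simp
    ring

theorem derivative_mk_deltaInid {L : ℕ} (a : Fin L → ℕ → ℝ) :
    d⁄dX ℝ (mk (deltaInid a)) = (∑ l, mk (aux (a l))) * mk (deltaInid a) := by
  ext n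
  rw [coeff_derivative, coeff_mul, Nat.sum_antidiagonal_eq_sum_range_succ_mk]
  simp only [coeff_mk, map_sum]
  rw [deltaInid, Fin.sum_univ_eq_sum_range (fun h => deltaInid a (n - h) * ∑ l, aux (a l) h)]
  field_simp
  exact sum_congr rfl fun k _ => mul_comm _ _

theorem mk_deltaInid {L : ℕ} {a : Fin L → ℕ → ℝ} (ha : ∀ l, a l 0 ≠ 0) :
    mk (deltaInid a) = ∏ l, mk (a l) :=
  eq_of_derivative_eq_mul (derivative_mk_deltaInid a)
    (derivation_prod_of_eq_mul _ _ fun l _ => derivative_mk_eq_mk_aux_mul (ha l))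
    (by simp [deltaInid_zero, map_prod])

-- The recursion for `deltaIid` with its left-hand side moved into the sum as the term `(0, n)`.
theorem sum_antidiagonal_deltaIid (L : ℕ) {a : ℕ → ℝ} (ha : a 0 ≠ 0) (n : ℕ) :
    ∑ ij ∈ antidiagonal n, a ij.1 * deltaIid L a ij.2 * (L * ij.1 - ij.2) = 0 := by
  cases n with
  | zero => simp
  | succ n =>
    rw [Nat.sum_antidiagonal_succ, deltaIid,
      Fin.sum_univ_eq_sum_range (fun h => deltaIid L a (n - h) * a (h + 1) *
        (((h : ℕ) + 1 : ℝ) * L + ((h : ℕ) + 1 : ℝ) - ((n : ℝ) + 1))),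
      Nat.sum_antidiagonal_eq_sum_range_succ_mk, mul_comm (a 0)]
    push_cast
    field_simp
    have hsum : ∑ k ∈ range (n + 1),
        deltaIid L a (n - k) * a (k + 1) * ((k + 1) * (L + 1) - (n + 1)) =
        ∑ k ∈ range n.succ, a (k + 1) * deltaIid L a (n - k) * (L * (k + 1) - (n - k : ℕ)) := by
      refine sum_congr rfl fun k hk => ?_
      rw [Nat.cast_sub (mem_range_succ_iff.1 hk)]
      ring
    rw [hsum]
    ring

theorem coeff_X_mul_derivative {A : Type*} [CommSemiring A] (f : A⟦X⟧) (i : ℕ) :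
    coeff i (X * d⁄dX A f) = i * coeff i f := by
  cases i with
  | zero => simp
  | succ i => rw [coeff_succ_X_mul, coeff_derivative, mul_comm, Nat.cast_succ]

theorem derivative_mk_deltaIid (L : ℕ) {a : ℕ → ℝ} (ha : a 0 ≠ 0) :
    d⁄dX ℝ (mk (deltaIid L a)) = (L * mk (aux a)) * mk (deltaIid L a) := by
  have hmk : mk a ≠ 0 := fun h => ha (by simpa using congrArg (coeff 0) h)
  refine mul_left_cancel₀ (mul_ne_zero X_ne_zero hmk) ?_
  suffices PowerSeries.mk a * (X * d⁄dX ℝ (PowerSeries.mk (deltaIid L a))) =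
      C (L : ℝ) * ((X * d⁄dX ℝ (PowerSeries.mk a)) * PowerSeries.mk (deltaIid L a)) by
    rw [derivative_mk_eq_mk_aux_mul ha, map_natCast] at this
    linear_combination this
  ext n
  rw [coeff_C_mul, coeff_mul, coeff_mul, mul_sum, eq_comm, ← sub_eq_zero, ← sum_sub_distrib,
    ← sum_antidiagonal_deltaIid L ha n]
  refine sum_congr rfl fun ij _ => ?_
  rw [coeff_X_mul_derivative, coeff_X_mul_derivative, coeff_mk, coeff_mk]
  ring

theorem deltaInid_const (L : ℕ) {a : ℕ → ℝ} (ha : a 0 ≠ 0) :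
    deltaInid (fun _ : Fin L => a) = deltaIid L a := by
  have hmk : mk (deltaInid fun _ : Fin L => a) = mk (deltaIid L a) := by
    refine eq_of_derivative_eq_mul (derivative_mk_deltaInid _) ?_
      (by simp [deltaInid_zero, deltaIid_zero])
    rw [derivative_mk_deltaIid L ha, sum_const, card_univ, Fintype.card_fin, nsmul_eq_mul]
  ext i
  simpa only [coeff_mk] using congrArg (coeff i) hmk

end LogarithmicDerivative

section Kernel

open Set

/-- The Riemann–Liouville kernel `r ^ (s - 1) / Γ s` of order `s`, whose Laplace transform is
`z ↦ z ^ (-s)`. Only its values at `s > 0` and `r > 0` are meaningful. -/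
noncomputable def rlKernel (s r : ℝ) : ℝ :=
  r ^ (s - 1) / Real.Gamma s

variable {s t r : ℝ}

theorem rlKernel_pos (hs : 0 < s) (hr : 0 < r) : 0 < rlKernel s r :=
  div_pos (Real.rpow_pos_of_pos hr _) (Real.Gamma_pos_of_pos hs)

theorem integral_rlKernel_mul (hs : 0 < s) (ht : 0 < t) (hr : 0 < r) :
    ∫ y in Ioo 0 r, rlKernel s y * rlKernel t (r - y) = rlKernel (s + t) r := by
  have hs' := (Real.Gamma_pos_of_pos hs).ne'
  have ht' := (Real.Gamma_pos_of_pos ht).ne'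
  have hbeta : ∫ y in Ioo 0 r, y ^ (s - 1) * (r - y) ^ (t - 1) =
      r ^ (s + t - 1) * (Real.Gamma s * Real.Gamma t / Real.Gamma (s + t)) := by
    have h := Complex.betaIntegral_scaled s t hr
    rw [Complex.betaIntegral_eq_Gamma_mul_div s t (by simpa) (by simpa),
      intervalIntegral.integral_of_le hr.le, integral_Ioc_eq_integral_Ioo,
      setIntegral_congr_fun (g := fun y => ((y ^ (s - 1) * (r - y) ^ (t - 1) : ℝ) : ℂ))
        measurableSet_Ioo fun y hy => by
          push_cast [Complex.ofReal_cpow hy.1.le, Complex.ofReal_cpow (sub_pos.2 hy.2).le]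
          rfl, integral_complex_ofReal] at h
    apply Complex.ofReal_injective
    push_cast [Complex.ofReal_cpow hr.le, ← Complex.Gamma_ofReal]
    exact h
  simp only [rlKernel, div_mul_div_comm, integral_div, hbeta]
  field_simp

theorem integrableOn_rlKernel_mul (hs : 0 < s) (ht : 0 < t) (hr : 0 < r) :
    IntegrableOn (fun y => rlKernel s y * rlKernel t (r - y)) (Ioo 0 r) := by
  refine Integrable.of_integral_ne_zero ?_
  rw [integral_rlKernel_mul hs ht hr]
  exact (rlKernel_pos (add_pos hs ht) hr).ne'

theorem rlKernel_mul_rlKernel_le {s₀ y : ℝ} (hs₀ : 0 < s₀) (hs : s₀ ≤ s) (hy : 0 < y)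
    (hyr : y ≤ r) : rlKernel s y * rlKernel s₀ r ≤ rlKernel s r * rlKernel s₀ y := by
  have hr := hy.trans_le hyr
  have hΓ := Real.Gamma_pos_of_pos hs₀
  have hΓ' := Real.Gamma_pos_of_pos (hs₀.trans_le hs)
  have hratio : (y / r) ^ (s - 1) ≤ (y / r) ^ (s₀ - 1) :=
    Real.rpow_le_rpow_of_exponent_ge (div_pos hy hr) ((div_le_one hr).2 hyr) (by linarith)
  rw [Real.div_rpow hy.le hr.le, Real.div_rpow hy.le hr.le,
    div_le_div_iff₀ (Real.rpow_pos_of_pos hr _) (Real.rpow_pos_of_pos hr _)] at hratio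
  simp only [rlKernel, div_mul_div_comm]
  exact div_le_div_of_nonneg_right (by linarith) (mul_pos hΓ' hΓ).le

theorem rlKernel_add_mul_le {s₀ t₀ : ℝ} (hs₀ : 0 < s₀) (ht₀ : 0 < t₀) (hs : s₀ ≤ s) (ht : t₀ ≤ t)
    (hr : 0 < r) :
    rlKernel (s + t) r * (rlKernel s₀ r * rlKernel t₀ r) ≤
      rlKernel s r * rlKernel t r * rlKernel (s₀ + t₀) r := by
  have hs' := hs₀.trans_le hs
  have ht' := ht₀.trans_le ht
  rw [← integral_rlKernel_mul hs' ht' hr, ← integral_rlKernel_mul hs₀ ht₀ hr, ← integral_mul_const,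
    ← integral_const_mul]
  refine setIntegral_mono_on ((integrableOn_rlKernel_mul hs' ht' hr).mul_const _)
    ((integrableOn_rlKernel_mul hs₀ ht₀ hr).const_mul _) measurableSet_Ioo fun y hy => ?_
  have hry : 0 < r - y := sub_pos.2 hy.2
  rw [mul_mul_mul_comm, mul_mul_mul_comm (rlKernel s r)]
  exact mul_le_mul (rlKernel_mul_rlKernel_le hs₀ hs hy.1 hy.2.le)
    (rlKernel_mul_rlKernel_le ht₀ ht hry (by linarith [hy.1]))
    (mul_pos (rlKernel_pos ht' hry) (rlKernel_pos ht₀ hr)).le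
    (mul_pos (rlKernel_pos hs' hr) (rlKernel_pos hs₀ hy.1)).le

end Kernel

section KernelSeries

open Set

/-- The `i`-th term of `kernelSeries`. -/
noncomputable def kernelTerm (α A : ℝ) (p : ℝ⟦X⟧) (r : ℝ) (i : ℕ) : ℝ :=
  coeff i p * rlKernel (α * i + A) r

/-- The series `∑ pᵢ r ^ (α i + A - 1) / Γ(α i + A)`, formally the inverse Laplace transform of
`z ^ (-A) * p (z ^ (-α))`, extended by zero to the nonpositive half-line. -/
noncomputable def kernelSeries (α A : ℝ) (p : ℝ⟦X⟧) (r : ℝ) : ℝ :=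
  if 0 < r then ∑' i, kernelTerm α A p r i else 0

variable {α A B r : ℝ} {p q : ℝ⟦X⟧}

theorem kernelSeries_of_pos (hr : 0 < r) :
    kernelSeries α A p r = ∑' i, kernelTerm α A p r i :=
  if_pos hr

theorem kernelSeries_of_nonpos (hr : r ≤ 0) : kernelSeries α A p r = 0 :=
  if_neg hr.not_gt

theorem kernelTerm_one_of_ne_zero {i : ℕ} (hi : i ≠ 0) : kernelTerm α A 1 r i = 0 := by
  rw [kernelTerm, coeff_one, if_neg hi, zero_mul]

theorem summable_kernelTerm_one : Summable (kernelTerm α A 1 r) :=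
  summable_of_ne_finset_zero (s := {0}) fun i hi =>
    kernelTerm_one_of_ne_zero (by simpa using hi)

theorem kernelSeries_one_one (α r : ℝ) : kernelSeries α 1 1 r = if 0 < r then 1 else 0 := by
  rw [kernelSeries, tsum_eq_single 0 fun i hi => kernelTerm_one_of_ne_zero hi]
  simp [kernelTerm, rlKernel]

theorem norm_kernelTerm (hα : 0 ≤ α) (hA : 0 < A) (hr : 0 < r) (i : ℕ) :
    ‖kernelTerm α A p r i‖ = ‖coeff i p‖ * rlKernel (α * i + A) r := by
  rw [kernelTerm, norm_mul, Real.norm_of_nonneg (rlKernel_pos (by positivity) hr).le]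

theorem kernelTerm_mul_kernelTerm (y z : ℝ) (i j : ℕ) :
    kernelTerm α A p y i * kernelTerm α B q z j =
      coeff i p * coeff j q * (rlKernel (α * i + A) y * rlKernel (α * j + B) z) :=
  mul_mul_mul_comm ..

theorem integrableOn_kernelTerm_mul (hα : 0 ≤ α) (hA : 0 < A) (hB : 0 < B) (hr : 0 < r)
    (i j : ℕ) :
    IntegrableOn (fun y => kernelTerm α A p y i * kernelTerm α B q (r - y) j) (Ioo 0 r) := by
  simp only [kernelTerm_mul_kernelTerm]
  exact (integrableOn_rlKernel_mul (by positivity) (by positivity) hr).const_mul _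

theorem integral_kernelTerm_mul (hα : 0 ≤ α) (hA : 0 < A) (hB : 0 < B) (hr : 0 < r) (i j : ℕ) :
    ∫ y in Ioo 0 r, kernelTerm α A p y i * kernelTerm α B q (r - y) j =
      coeff i p * coeff j q * rlKernel (α * i + A + (α * j + B)) r := by
  simp only [kernelTerm_mul_kernelTerm]
  rw [integral_const_mul, integral_rlKernel_mul (by positivity) (by positivity) hr]

theorem integral_norm_kernelTerm_mul (hα : 0 ≤ α) (hA : 0 < A) (hB : 0 < B) (hr : 0 < r)
    (i j : ℕ) :
    ∫ y in Ioo 0 r, ‖kernelTerm α A p y i * kernelTerm α B q (r - y) j‖ =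
      ‖coeff i p‖ * ‖coeff j q‖ * rlKernel (α * i + A + (α * j + B)) r := by
  rw [← integral_rlKernel_mul (by positivity) (by positivity) hr, ← integral_const_mul]
  refine setIntegral_congr_fun measurableSet_Ioo fun y hy => ?_
  simp only [norm_mul, norm_kernelTerm hα hA hy.1, norm_kernelTerm hα hB (sub_pos.2 hy.2)]
  exact mul_mul_mul_comm ..

theorem summable_integral_norm_kernelTerm_mul (hα : 0 ≤ α) (hA : 0 < A) (hB : 0 < B) (hr : 0 < r)
    (hp : Summable (kernelTerm α A p r)) (hq : Summable (kernelTerm α B q r)) :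
    Summable fun ij : ℕ × ℕ =>
      ∫ y in Ioo 0 r, ‖kernelTerm α A p y ij.1 * kernelTerm α B q (r - y) ij.2‖ := by
  refine Summable.of_nonneg_of_le (fun _ => integral_nonneg fun _ => norm_nonneg _)
    (fun ij => ?_)
    ((hp.norm.mul_of_nonneg hq.norm (fun _ => norm_nonneg _) fun _ => norm_nonneg _).mul_right
      (rlKernel (A + B) r / (rlKernel A r * rlKernel B r)))
  have hle : rlKernel (α * ij.1 + A + (α * ij.2 + B)) r ≤
      rlKernel (α * ij.1 + A) r * rlKernel (α * ij.2 + B) r *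
        (rlKernel (A + B) r / (rlKernel A r * rlKernel B r)) := by
    rw [← mul_div_assoc, le_div_iff₀ (mul_pos (rlKernel_pos hA hr) (rlKernel_pos hB hr))]
    exact rlKernel_add_mul_le hA hB (le_add_of_nonneg_left (by positivity))
      (le_add_of_nonneg_left (by positivity)) hr
  rw [integral_norm_kernelTerm_mul hα hA hB hr, norm_kernelTerm hα hA hr,
    norm_kernelTerm hα hB hr, mul_mul_mul_comm (‖coeff ij.1 p‖), mul_assoc (_ * _)]
  gcongr

theorem integral_kernelSeries_mul_eq_setIntegral (r : ℝ) :
    ∫ y, kernelSeries α A p y * kernelSeries α B q (r - y) =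
      ∫ y in Ioo 0 r, kernelSeries α A p y * kernelSeries α B q (r - y) := by
  refine (setIntegral_eq_integral_of_forall_compl_eq_zero fun y hy => ?_).symm
  rcases le_or_gt y 0 with hy0 | hy0
  · rw [kernelSeries_of_nonpos hy0, zero_mul]
  · rw [kernelSeries_of_nonpos (r := r - y) (sub_nonpos.2 (not_lt.1 fun h => hy ⟨hy0, h⟩)),
      mul_zero]

theorem hasSum_kernelTerm_mul (hα : 0 ≤ α) (hA : 0 < A) (hB : 0 < B)
    (hp : ∀ r, 0 < r → Summable (kernelTerm α A p r))
    (hq : ∀ r, 0 < r → Summable (kernelTerm α B q r)) (hr : 0 < r) :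
    HasSum (kernelTerm α (A + B) (p * q) r)
      (∫ y, kernelSeries α A p y * kernelSeries α B q (r - y)) := by
  have hpair : HasSum
      (fun ij : ℕ × ℕ => coeff ij.1 p * coeff ij.2 q * rlKernel (α * ij.1 + A + (α * ij.2 + B)) r)
      (∫ y, kernelSeries α A p y * kernelSeries α B q (r - y)) := by
    have h := hasSum_integral_of_summable_integral_norm
      (fun ij : ℕ × ℕ => integrableOn_kernelTerm_mul (p := p) (q := q) hα hA hB hr ij.1 ij.2)
      (summable_integral_norm_kernelTerm_mul hα hA hB hr (hp r hr) (hq r hr))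
    simp only [integral_kernelTerm_mul hα hA hB hr] at h
    rw [integral_kernelSeries_mul_eq_setIntegral]
    convert! h using 1
    refine setIntegral_congr_fun measurableSet_Ioo fun y hy => ?_
    have hry : 0 < r - y := sub_pos.2 hy.2
    simp only [kernelSeries_of_pos hy.1, kernelSeries_of_pos hry]
    exact tsum_mul_tsum_of_summable_norm (hp y hy.1).norm (hq _ hry).norm
  refine ((HasAntidiagonal.sigmaAntidiagonalEquivProd.hasSum_iff).2 hpair).sigma fun n => ?_
  have hcoeff : kernelTerm α (A + B) (p * q) r n = ∑ ij : HasAntidiagonal.antidiagonal n,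
      coeff ij.1.1 p * coeff ij.1.2 q * rlKernel (α * ij.1.1 + A + (α * ij.1.2 + B)) r := by
    rw [kernelTerm, coeff_mul, sum_mul, ← sum_coe_sort]
    refine Finset.sum_congr rfl fun ij _ => ?_
    have hij : (n : ℝ) = ij.1.1 + ij.1.2 := by exact_mod_cast (mem_antidiagonal.1 ij.2).symm
    rw [show α * n + (A + B) = α * ij.1.1 + A + (α * ij.1.2 + B) by rw [hij]; ring]
  rw [hcoeff]
  exact hasSum_fintype _

theorem integral_kernelSeries_mul (hα : 0 ≤ α) (hA : 0 < A) (hB : 0 < B)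
    (hp : ∀ r, 0 < r → Summable (kernelTerm α A p r))
    (hq : ∀ r, 0 < r → Summable (kernelTerm α B q r)) (r : ℝ) :
    ∫ y, kernelSeries α A p y * kernelSeries α B q (r - y) =
      kernelSeries α (A + B) (p * q) r := by
  rcases le_or_gt r 0 with hr | hr
  · rw [integral_kernelSeries_mul_eq_setIntegral, Ioo_eq_empty hr.not_gt, setIntegral_empty,
      kernelSeries_of_nonpos hr]
  · rw [kernelSeries_of_pos hr, (hasSum_kernelTerm_mul hα hA hB hp hq hr).tsum_eq]

theorem summable_kernelTerm_add_one (hα : 0 ≤ α) (hA : 0 < A)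
    (hp : ∀ r, 0 < r → Summable (kernelTerm α A p r)) (hr : 0 < r) :
    Summable (kernelTerm α (A + 1) p r) := by
  simpa only [mul_one] using
    (hasSum_kernelTerm_mul hα hA one_pos hp (fun _ _ => summable_kernelTerm_one) hr).summable

theorem setIntegral_Iic_kernelSeries (hα : 0 ≤ α) (hA : 0 < A)
    (hp : ∀ r, 0 < r → Summable (kernelTerm α A p r)) (r : ℝ) :
    ∫ y in Iic r, kernelSeries α A p y = kernelSeries α (A + 1) p r := by
  have hconv :=
    integral_kernelSeries_mul hα hA one_pos hp (fun _ _ => summable_kernelTerm_one) r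
  rw [mul_one] at hconv
  rw [← hconv, integral_Iic_eq_integral_Iio, ← integral_indicator measurableSet_Iio]
  refine integral_congr_ae (ae_of_all _ fun y => ?_)
  simp only [indicator_apply, Set.mem_Iio, kernelSeries_one_one, sub_pos, mul_ite, mul_one,
    mul_zero]

end KernelSeries

section Density

open Set

variable {Ω : Type*} [MeasurableSpace Ω] {P : Measure Ω} {X Y : Ω → ℝ} {f g : ℝ → ℝ}

theorem HasDensity.aestronglyMeasurable (hX : HasDensity X P f) :
    AEStronglyMeasurable f volume := by
  refine (measurable_pdf X P volume).ennreal_toReal.aestronglyMeasurable.congr ?_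
  filter_upwards [hX.2.1, hX.2.2] with r hr hpdf
  rw [hpdf, ENNReal.toReal_ofReal hr]

theorem HasDensity.measureReal_le (hX : HasDensity X P f) (r : ℝ) :
    P.real {ω | X ω ≤ r} = ∫ y in Iic r, f y := by
  have ⟨_, hf, hpdf⟩ := hX
  rw [integral_eq_lintegral_of_nonneg_ae (ae_restrict_of_ae hf) hX.aestronglyMeasurable.restrict,
    measureReal_def, ← lintegral_congr_ae (ae_restrict_of_ae hpdf),
    ← map_eq_setLIntegral_pdf X P volume measurableSet_Iic,
    Measure.map_apply_of_aemeasurable (HasPDF.aemeasurable X P volume) measurableSet_Iic]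
  rfl

theorem HasDensity.add [IsFiniteMeasure P] (hX : HasDensity X P f) (hY : HasDensity Y P g)
    (hXY : IndepFun X Y P) : HasDensity (X + Y) P fun r => ∫ y, f y * g (r - y) := by
  have ⟨_, hf, hpdfX⟩ := hX
  have ⟨_, hg, hpdfY⟩ := hY
  have hsub (r : ℝ) : Measure.QuasiMeasurePreserving (r - · : ℝ → ℝ) :=
    (Measure.measurePreserving_sub_left volume r).quasiMeasurePreserving
  have hnonneg (r : ℝ) : ∀ᵐ y, 0 ≤ f y * g (r - y) := by
    filter_upwards [hf, (hsub r).ae hg] with y hfy hgy using mul_nonneg hfy hgy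
  have hconv (r : ℝ) : (pdf X P ⋆ₗ pdf Y P) r = ∫⁻ y, ENNReal.ofReal (f y * g (r - y)) := by
    rw [lconvolution_def]
    refine lintegral_congr_ae ?_
    filter_upwards [hf, hpdfX, (hsub r).ae hpdfY] with y hfy hXy hYy
    rw [ENNReal.ofReal_mul hfy, hXy, neg_add_eq_sub, hYy]
  have hfinite : ∀ᵐ r, pdf (X + Y) P volume r < ⊤ := pdf.ae_lt_top
  refine ⟨hXY.add_hasPDF, ae_of_all _ fun r => integral_nonneg_of_ae (hnonneg r), ?_⟩
  filter_upwards [hXY.pdf_add_eq_lconvolution_pdf (μ := volume), hfinite]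
    with r hr hlt
  rw [hr, hconv] at hlt
  rw [hr, hconv, integral_eq_lintegral_of_nonneg_ae (hnonneg r)
    (hX.aestronglyMeasurable.mul (hY.aestronglyMeasurable.comp_quasiMeasurePreserving (hsub r))),
    ENNReal.ofReal_toReal hlt.ne]

/-- The density of `X` is a `kernelSeries`, absolutely convergent on the positive half-line. -/
def HasKernelDensity (X : Ω → ℝ) (P : Measure Ω) (α A : ℝ) (p : ℝ⟦X⟧) : Prop :=
  (∀ r, 0 < r → Summable (kernelTerm α A p r)) ∧ HasDensity X P (kernelSeries α A p)

theorem HasKernelDensity.add [IsFiniteMeasure P] {α A B : ℝ} {p q : ℝ⟦X⟧} (hα : 0 ≤ α)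
    (hA : 0 < A) (hB : 0 < B) (hX : HasKernelDensity X P α A p)
    (hY : HasKernelDensity Y P α B q) (hXY : IndepFun X Y P) :
    HasKernelDensity (X + Y) P α (A + B) (p * q) := by
  refine ⟨fun r hr => (hasSum_kernelTerm_mul hα hA hB hX.1 hY.1 hr).summable, ?_⟩
  rw [← funext (integral_kernelSeries_mul hα hA hB hX.1 hY.1)]
  exact hX.2.add hY.2 hXY

theorem HasKernelDensity.sum {ι : Type*} {R : ι → Ω → ℝ} {α : ℝ} {A : ι → ℝ} {p : ι → ℝ⟦X⟧}
    (hα : 0 ≤ α) (hA : ∀ l, 0 < A l) (hR : ∀ l, HasKernelDensity (R l) P α (A l) (p l))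
    (hindep : iIndepFun R P) {s : Finset ι} (hs : s.Nonempty) :
    HasKernelDensity (∑ l ∈ s, R l) P α (∑ l ∈ s, A l) (∏ l ∈ s, p l) := by
  have := hindep.isProbabilityMeasure
  induction hs using Finset.Nonempty.cons_induction with
  | singleton l => simpa only [sum_singleton, Finset.prod_singleton] using hR l
  | cons l s hl hs ih =>
    have hmeas (i : ι) : AEMeasurable (R i) P :=
      have := (hR i).2.1
      HasPDF.aemeasurable (R i) P volume
    rw [sum_cons, sum_cons, prod_cons]
    exact (hR l).add hα (hA l) (sum_pos (fun i _ => hA i) hs) ih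
      (hindep.indepFun_finsetSum_of_notMem₀ hmeas hl).symm

theorem HasKernelDensity.measureReal_le {α A : ℝ} {p : ℝ⟦X⟧} (hα : 0 ≤ α) (hA : 0 < A)
    (hX : HasKernelDensity X P α A p) (r : ℝ) :
    P.real {ω | X ω ≤ r} = kernelSeries α (A + 1) p r := by
  rw [hX.2.measureReal_le, setIntegral_Iic_kernelSeries hα hA hX.1]

end Density

section Mixture

/-- The power series `p` for which the density of an `α`-`μ` mixture is
`kernelSeries α (α * T) p`. -/
noncomputable def mixtureSeries (α T rhat : ℝ) (φ : ℕ → ℝ) : ℝ⟦X⟧ :=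
  C (α / rhat ^ (α * T)) * mk (lam α T rhat φ)

variable {α T rhat r : ℝ} {φ : ℕ → ℝ}

theorem lam_zero_ne_zero (hα : 0 < α) (hT : 0 < T) (hφ : φ 0 ≠ 0) : lam α T rhat φ 0 ≠ 0 := by
  have hΓ := (Real.Gamma_pos_of_pos (mul_pos hα hT)).ne'
  have hΓ' := (Real.Gamma_pos_of_pos hT).ne'
  simp [lam, hΓ, hΓ', hφ]

theorem mixtureTerm_eq (hrhat : 0 < rhat) (hr : 0 < r) (i : ℕ) :
    mixtureTerm α T rhat φ r i =
      r ^ (α * T - 1) / rhat ^ (α * T) * (φ i / Real.Gamma (i + T) * (r ^ α / rhat ^ α) ^ i) := by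
  rw [mixtureTerm, show α * (i + T) - 1 = (α * T - 1) + α * i by ring, mul_add, Real.rpow_add hr,
    Real.rpow_add hrhat, Real.rpow_mul_natCast hr.le, Real.rpow_mul_natCast hrhat.le, div_pow]
  ring

theorem kernelTerm_mixtureSeries (hα : 0 < α) (hT : 0 < T) (hrhat : 0 < rhat) (hr : 0 < r)
    (i : ℕ) :
    kernelTerm α (α * T) (mixtureSeries α T rhat φ) r i =
      α * (r ^ (α * T - 1) / rhat ^ (α * T)) *
        ∑ j ∈ range (i + 1), φ j / Real.Gamma (j + T) * (r ^ α / rhat ^ α) ^ j *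
          ((-(r ^ α / rhat ^ α)) ^ (i - j) / (i - j).factorial) := by
  have hΓ : Real.Gamma (α * (i + T)) ≠ 0 := (Real.Gamma_pos_of_pos (by positivity)).ne'
  have hpow (x : ℝ) : ∑ j ∈ range (i + 1), φ j / Real.Gamma (j + T) * x ^ j *
        ((-x) ^ (i - j) / (i - j).factorial) =
      x ^ i * ∑ j ∈ range (i + 1),
        (-1 : ℝ) ^ (i - j) * φ j / ((i - j).factorial * Real.Gamma (j + T)) := by
    rw [mul_sum]
    refine sum_congr rfl fun j hj => ?_
    rw [neg_pow x, ← pow_mul_pow_sub x (mem_range_succ_iff.1 hj)]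
    ring
  rw [hpow, kernelTerm, rlKernel, mixtureSeries, coeff_C_mul, coeff_mk, lam, ← mul_add,
    show α * (i + T) - 1 = (α * T - 1) + α * i by ring, Real.rpow_add hr,
    Real.rpow_mul_natCast hr.le, Real.rpow_mul_natCast hrhat.le, div_pow]
  field_simp

theorem hasSum_kernelTerm_mixtureSeries (hα : 0 < α) (hT : 0 < T) (hrhat : 0 < rhat) (hr : 0 < r)
    (h : Summable (mixtureTerm α T rhat φ r)) :
    HasSum (kernelTerm α (α * T) (mixtureSeries α T rhat φ) r) (mixturePDF α T rhat φ r) := by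
  have hc : r ^ (α * T - 1) / rhat ^ (α * T) ≠ 0 := by positivity
  simp only [mixturePDF, if_pos hr, funext (kernelTerm_mixtureSeries hα hT hrhat hr),
    funext (mixtureTerm_eq hrhat hr), summable_mul_left_iff hc, tsum_mul_left] at h ⊢
  generalize r ^ α / rhat ^ α = x at h ⊢
  have hexp : HasSum (fun n : ℕ => (-x) ^ n / n.factorial) (Real.exp (-x)) := by
    rw [Real.exp_eq_exp_ℝ]
    exact NormedSpace.expSeries_div_hasSum_exp (-x)
  have hprod := (hasSum_sum_range_mul_of_summable_norm h.norm hexp.summable.norm).mul_left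
    (α * (r ^ (α * T - 1) / rhat ^ (α * T)))
  rw [hexp.tsum_eq] at hprod
  convert! hprod using 1
  ring

theorem IsMixture.hasKernelDensity {Ω : Type*} [MeasurableSpace Ω] {P : Measure Ω} {X : Ω → ℝ}
    (hα : 0 < α) (hT : 0 < T) (hrhat : 0 < rhat) (hX : IsMixture X P α T rhat φ) :
    HasKernelDensity X P α (α * T) (mixtureSeries α T rhat φ) := by
  have hsum (r : ℝ) (hr : 0 < r) :=
    hasSum_kernelTerm_mixtureSeries hα hT hrhat hr (hX.1 r hr)
  refine ⟨fun r hr => (hsum r hr).summable, ?_⟩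
  convert! hX.2 using 1
  ext r
  rcases le_or_gt r 0 with hr | hr
  · rw [kernelSeries_of_nonpos hr, mixturePDF, if_neg hr.not_gt]
  · rw [kernelSeries_of_pos hr, (hsum r hr).tsum_eq]

end Mixture

section SumOfMixtures

variable {L : ℕ} {α : ℝ} {T rhat : Fin L → ℝ} {φ : Fin L → ℕ → ℝ}

theorem coeff_prod_mixtureSeries (hlam : ∀ l, lam α (T l) (rhat l) (φ l) 0 ≠ 0) (i : ℕ) :
    coeff i (∏ l, mixtureSeries α (T l) (rhat l) (φ l)) =
      α ^ L * (∏ l, 1 / rhat l ^ (α * T l)) *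
        deltaInid (fun l => lam α (T l) (rhat l) (φ l)) i := by
  simp only [mixtureSeries, prod_mul_distrib, ← mk_deltaInid hlam, ← map_prod, coeff_C_mul,
    coeff_mk, div_eq_mul_one_div α, prod_const, card_univ, Fintype.card_fin]

theorem kernelTerm_prod_mixtureSeries (hlam : ∀ l, lam α (T l) (rhat l) (φ l) 0 ≠ 0) (r : ℝ) :
    kernelTerm α (α * ∑ l, T l) (∏ l, mixtureSeries α (T l) (rhat l) (φ l)) r =
      fun i => α ^ L * (∏ l, 1 / rhat l ^ (α * T l)) * pdfTermInid α T rhat φ r i := by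
  ext i
  rw [kernelTerm, rlKernel, coeff_prod_mixtureSeries hlam, pdfTermInid, mul_comm (i : ℝ) α,
    show α * i + α * ∑ l, T l - 1 = -1 + α * i + α * ∑ l, T l by ring]
  ring

theorem kernelTerm_add_one_prod_mixtureSeries (hlam : ∀ l, lam α (T l) (rhat l) (φ l) 0 ≠ 0)
    (r : ℝ) :
    kernelTerm α (α * ∑ l, T l + 1) (∏ l, mixtureSeries α (T l) (rhat l) (φ l)) r =
      fun i => α ^ L * (∏ l, 1 / rhat l ^ (α * T l)) * cdfTermInid α T rhat φ r i := by
  ext i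
  rw [kernelTerm, rlKernel, coeff_prod_mixtureSeries hlam, cdfTermInid, mul_comm (i : ℝ) α,
    ← add_assoc, add_sub_cancel_right, add_assoc 1, add_comm 1]
  ring

theorem kernelSeries_prod_mixtureSeries (hlam : ∀ l, lam α (T l) (rhat l) (φ l) 0 ≠ 0) :
    kernelSeries α (α * ∑ l, T l) (∏ l, mixtureSeries α (T l) (rhat l) (φ l)) =
      fun r => if 0 < r then pdfInid α T rhat φ r else 0 := by
  ext r
  rw [kernelSeries, kernelTerm_prod_mixtureSeries hlam, tsum_mul_left, pdfInid]

theorem cdfTermInid_zero (hα : 0 ≤ α) (hT : 0 < α * ∑ l, T l) : cdfTermInid α T rhat φ 0 = 0 := by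
  ext i
  have hexp : α * i + α * ∑ l, T l ≠ 0 := by positivity
  rw [cdfTermInid, Real.zero_rpow hexp, mul_zero, zero_div, Pi.zero_apply]

theorem kernelSeries_add_one_prod_mixtureSeries (hα : 0 ≤ α) (hT : 0 < α * ∑ l, T l)
    (hlam : ∀ l, lam α (T l) (rhat l) (φ l) 0 ≠ 0) {r : ℝ} (hr : 0 ≤ r) :
    kernelSeries α (α * ∑ l, T l + 1) (∏ l, mixtureSeries α (T l) (rhat l) (φ l)) r =
      cdfInid α T rhat φ r := by
  rcases hr.eq_or_lt with rfl | hr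
  · rw [kernelSeries_of_nonpos le_rfl, cdfInid, cdfTermInid_zero hα hT]
    simp only [Pi.zero_apply, tsum_zero, mul_zero]
  · rw [kernelSeries_of_pos hr, kernelTerm_add_one_prod_mixtureSeries hlam, tsum_mul_left, cdfInid]

end SumOfMixtures

section IdenticalParameters

variable {L : ℕ} {α T rhat : ℝ} {φ : ℕ → ℝ}

theorem pdfTermInid_const (hlam : lam α T rhat φ 0 ≠ 0) :
    pdfTermInid α (fun _ : Fin L => T) (fun _ => rhat) (fun _ => φ) = pdfTermIid L α T rhat φ := by
  ext r i
  simp only [pdfTermInid, pdfTermIid, deltaInid_const L hlam, sum_const, card_univ,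
    Fintype.card_fin, nsmul_eq_mul, mul_assoc]

theorem cdfTermInid_const (hlam : lam α T rhat φ 0 ≠ 0) :
    cdfTermInid α (fun _ : Fin L => T) (fun _ => rhat) (fun _ => φ) = cdfTermIid L α T rhat φ := by
  ext r i
  simp only [cdfTermInid, cdfTermIid, deltaInid_const L hlam, sum_const, card_univ,
    Fintype.card_fin, nsmul_eq_mul, mul_assoc]

theorem pow_mul_prod_const_one_div_rpow (hrhat : 0 ≤ rhat) :
    α ^ L * ∏ _l : Fin L, 1 / rhat ^ (α * T) = α ^ L / rhat ^ (α * T * L) := by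
  rw [prod_const, card_univ, Fintype.card_fin, one_div_pow, Real.rpow_mul_natCast hrhat,
    mul_one_div]

theorem pdfInid_const (hrhat : 0 ≤ rhat) (hlam : lam α T rhat φ 0 ≠ 0) :
    pdfInid α (fun _ : Fin L => T) (fun _ => rhat) (fun _ => φ) = pdfIid L α T rhat φ := by
  ext r
  rw [pdfInid, pdfIid, pdfTermInid_const hlam, pow_mul_prod_const_one_div_rpow hrhat]

theorem cdfInid_const (hrhat : 0 ≤ rhat) (hlam : lam α T rhat φ 0 ≠ 0) :
    cdfInid α (fun _ : Fin L => T) (fun _ => rhat) (fun _ => φ) = cdfIid L α T rhat φ := by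
  ext r
  rw [cdfInid, cdfIid, cdfTermInid_const hlam, pow_mul_prod_const_one_div_rpow hrhat]

end IdenticalParameters

end AlphaMu

open AlphaMu Finset in
theorem corollary2_general {Ω : Type*} [MeasurableSpace Ω] {P : Measure Ω} {L : ℕ} (hL : 1 ≤ L)
    {α : ℝ} {T rhat : Fin L → ℝ} (hα : 0 < α) (hT : ∀ l, 0 < T l) (hrhat : ∀ l, 0 < rhat l)
    {φ : Fin L → ℕ → ℝ} (hφ : ∀ l, φ l 0 ≠ 0) {R : Fin L → Ω → ℝ} (hindep : iIndepFun R P)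
    (hR : ∀ l, IsMixture (R l) P α (T l) (rhat l) (φ l)) :
    (∀ r : ℝ, 0 < r → Summable (pdfTermInid α T rhat φ r)) ∧
    HasDensity (fun ω => ∑ l, R l ω) P (fun r => if 0 < r then pdfInid α T rhat φ r else 0) ∧
    (∀ r : ℝ, 0 ≤ r → Summable (cdfTermInid α T rhat φ r) ∧
      P.real {ω | ∑ l, R l ω ≤ r} = cdfInid α T rhat φ r) ∧
    ∀ r : ℝ, r < 0 → P.real {ω | ∑ l, R l ω ≤ r} = 0 := by
  have : NeZero L := ⟨by omega⟩
  have hlam (l : Fin L) : lam α (T l) (rhat l) (φ l) 0 ≠ 0 := lam_zero_ne_zero hα (hT l) (hφ l)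
  have hA : 0 < α * ∑ l, T l := mul_pos hα (sum_pos (fun l _ => hT l) univ_nonempty)
  have hc : α ^ L * ∏ l, 1 / rhat l ^ (α * T l) ≠ 0 :=
    (mul_pos (pow_pos hα L) (prod_pos fun l _ => by have := hrhat l; positivity)).ne'
  have hsum : HasKernelDensity (fun ω => ∑ l, R l ω) P α (α * ∑ l, T l)
      (∏ l, mixtureSeries α (T l) (rhat l) (φ l)) := by
    simpa only [mul_sum, sum_fn] using HasKernelDensity.sum hα.le (fun l => mul_pos hα (hT l))
      (fun l => (hR l).hasKernelDensity hα (hT l) (hrhat l)) hindep univ_nonempty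
  refine ⟨fun r hr => ?_, ?_, fun r hr => ⟨?_, ?_⟩, fun r hr => ?_⟩
  · simpa only [kernelTerm_prod_mixtureSeries hlam, summable_mul_left_iff hc] using hsum.1 r hr
  · simpa only [kernelSeries_prod_mixtureSeries hlam] using hsum.2
  · rcases hr.eq_or_lt with rfl | hr
    · rw [cdfTermInid_zero hα.le hA]
      exact summable_zero
    · simpa only [kernelTerm_add_one_prod_mixtureSeries hlam, summable_mul_left_iff hc] using
        summable_kernelTerm_add_one hα.le hA hsum.1 hr
  · rw [hsum.measureReal_le hα.le hA, kernelSeries_add_one_prod_mixtureSeries hα.le hA hlam hr]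
  · rw [hsum.measureReal_le hα.le hA, kernelSeries_of_nonpos hr.le]

theorem corollary2 {Ω : Type*} [MeasurableSpace Ω] (P : Measure Ω) [IsProbabilityMeasure P]
    (L : ℕ) (hL : 1 ≤ L) (α T rhat : ℝ) (hα : 0 < α) (hT : 0 < T) (hrhat : 0 < rhat)
    (φ : ℕ → ℝ) (hφ : φ 0 ≠ 0) (R : Fin L → Ω → ℝ)
    (hindep : iIndepFun R P) (hR : ∀ l, AlphaMu.IsMixture (R l) P α T rhat φ) :
    -- the series converge absolutely, and are the PDF and the CDF of the sum
    (∀ r : ℝ, 0 < r → Summable (AlphaMu.pdfTermIid L α T rhat φ r)) ∧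
    AlphaMu.HasDensity (fun ω => ∑ l, R l ω) P
      (fun r => if 0 < r then AlphaMu.pdfIid L α T rhat φ r else 0) ∧
    (∀ r : ℝ, 0 ≤ r → Summable (AlphaMu.cdfTermIid L α T rhat φ r) ∧
      P.real {ω | ∑ l, R l ω ≤ r} = AlphaMu.cdfIid L α T rhat φ r) ∧
    (∀ r : ℝ, r < 0 → P.real {ω | ∑ l, R l ω ≤ r} = 0) ∧
    -- the general formulas reduce to these ones
    (∀ i : ℕ, AlphaMu.deltaInid (fun _ : Fin L => AlphaMu.lam α T rhat φ) i =
      AlphaMu.deltaIid L (AlphaMu.lam α T rhat φ) i) ∧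
    (∀ r : ℝ, 0 < r → AlphaMu.pdfInid α (fun _ : Fin L => T) (fun _ => rhat) (fun _ => φ) r =
      AlphaMu.pdfIid L α T rhat φ r) ∧
    (∀ r : ℝ, 0 ≤ r → AlphaMu.cdfInid α (fun _ : Fin L => T) (fun _ => rhat) (fun _ => φ) r =
      AlphaMu.cdfIid L α T rhat φ r) := by
  open AlphaMu in
  have hlam : lam α T rhat φ 0 ≠ 0 := lam_zero_ne_zero hα hT hφ
  obtain ⟨hpdf, hdens, hcdf, hneg⟩ :=
    corollary2_general hL hα (fun _ => hT) (fun _ => hrhat) (fun _ => hφ) hindep hR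
  simp only [pdfTermInid_const hlam, cdfTermInid_const hlam, pdfInid_const hrhat.le hlam,
    cdfInid_const hrhat.le hlam] at hpdf hdens hcdf
  exact ⟨hpdf, hdens, hcdf, hneg, congrFun (deltaInid_const L hlam),
    fun r _ => congrFun (pdfInid_const hrhat.le hlam) r,
    fun r _ => congrFun (cdfInid_const hrhat.le hlam) r⟩
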